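/- Let $0<m<n$ be integers and let $P=\mathbb Z e_0\oplus\cdots\oplus\mathbb Z e_n$ carry the form $\langle x,y\rangle=-(m-2)x_0y_0+\sum_{i=1}^n x_iy_i$. Put $\alpha_0=e_0-e_1-\cdots-e_m$, $\alpha_i=e_i-e_{i+1}$ $(1\le i\le n-1)$, let $s_i(L)=L-\langle\alpha_i,L\rangle\alpha_i$, let $W=W_{m,n}=\langle s_0,\dots,s_{n-1}\rangle$ be the Weyl group, and let $M=W.e_1\subset P$. Let $K$ be the field of meromorphic functions on $\mathbb C^{n+1}$ in the variables $(\varepsilon_0,\dots,\varepsilon_n)$. For $\Lambda=\sum\Lambda_ie_i\in P$ the linear form $\sum\Lambda_i\varepsilon_i$ is also denoted by $\Lambda$ (so $e_i$ corresponds to $\varepsilon_i$), and $W$ acts on $K$ by the substitution of variables that sends each such linear form $\Lambda$ to $w.\Lambda$. Let $[x]=\vartheta_{11}(x)$ be the odd theta function with a fixed modulus in the upper half plane, and let $$c_{i,j}=\frac{[\varepsilon_i-\varepsilon_{m+1}]\,[\alpha_0+\varepsilon_j-\varepsilon_{m+1}]}{[\varepsilon_i-\varepsilon_j]\,[\alpha_0]}\in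 K .$$ Let $F$ be a commutative $K$-algebra ("functions") and let $\tau(\Lambda)$ $(\Lambda\in M)$ be any family of invertible elements of $F$. Put $\tau_j=\tau(e_j)$ $(1\le j\le n)$ and $f_i=\tau(s_0.e_i)/\tau(e_i)$ $(1\le i\le m)$. Consider the birational transformations - $s_0(\tau_i)=f_i\tau_i$ $(1\le i\le m)$, $\ s_0(\tau_j)=\tau_j$ $(m<j\le n)$; for $1\le i\le n-1$: $s_i(\tau_i)=\tau_{i+1}$, $s_i(\tau_{i+1})=\tau_i$, $s_i(\tau_j)=\tau_j$ $(j\ne i,i+1)$; - $s_0(f_i)=1/f_i$ $(1\le i\le m)$; $\ s_i(f_i)=f_{i+1}$, $s_i(f_{i+1})=f_i$ $(1\le i\le m-1)$; $\ s_m(f_i)=\frac{\tau_m}{\tau_{m+1}}(c_{i,m}f_i+c_{m,i}f_m)$ $(1\le i\le m-1)$; $\ s_m(f_m)=\frac{\tau_m}{\tau_{m+1}}f_m$; $\ s_i(f_j)=f_j$ in all other cases with $1\le i\le n-1$, $1\le j\le m$, and the bilinear relations $$[\varepsilon_j-\varepsilon_k][L-\varepsilon_j-\varepsilon_k]\tau(e_i)\tau(L-e_i)+[\varepsilon_k-\varepsilon_i][L-\varepsilon_k-\varepsilon_i]\tau(e_j)\tau(L-e_j)+[\varepsilon_i-\varepsilon_j][L-\varepsilon_i-\varepsilon_j]\tau(e_k)\tau(L-e_k)=0\qquad(\ast)$$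 for all mutually distinct $i,j,k,l_1,\dots,l_{m-2}\in\{1,\dots,n\}$, where $L=e_0-e_{l_1}-\cdots-e_{l_{m-2}}$ (no relations if $m=1$). (i) Suppose that $W$ acts on $F$ by ring automorphisms through its action on $M$, that is, extending the action of $W$ on $K$ and with $w(\tau(\Lambda))=\tau(w.\Lambda)$ for all $w\in W$, $\Lambda\in M$. Then this action is given on the $f_i$ and $\tau_j$ by the birational transformations above if and only if the bilinear relations $(\ast)$ hold. (ii) Without any action of $W$ on $F$: call the action of $W$ on $M$ consistent with the birational transformations for $\tau$ if there are a commutative $K$-algebra $A$ with an action of $W$ by ring automorphisms extending the action on $K$, a family of invertible elements $T(\Lambda)\in A$ $(\Lambda\in M)$ with $w(T(\Lambda))=T(w.\Lambda)$ for which the birational transformations hold, and a homomorphism of $K$-algebras $A\to F$ that sends $T(\Lambda)$ to $\tau(\Lambda)$ for all $\Lambda\in M$. Then the action is consistent if and only if $\tau$ satisfies the bilinear relations $(\ast)$ together with all their transforms under $W$ (for each $w\in W$, every $\tau(\Lambda)$ is replaced by $\tau(w.\Lambda)$ and every coefficient $a\in K$ by $w.a$). -/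

import Mathlib

open UpperHalfPlane

namespace EllTau

noncomputable section

/-! ### The lattice, the simple roots, the Weyl group and its orbit -/

/-- The lattice `P = ℤ e₀ ⊕ ℤ e₁ ⊕ ⋯ ⊕ ℤ eₙ`. -/
abbrev Lat (n : ℕ) : Type := Fin (n + 1) → ℤ

/-- The basis vectors `e₀, …, eₙ` (only the indices `0 ≤ i ≤ n` are used). -/
def e (n i : ℕ) : Lat n := fun k => if (k : ℕ) = i then 1 else 0

/-- The metric `⟨x, y⟩ = -(m-2) x₀ y₀ + x₁ y₁ + ⋯ + xₙ yₙ`. -/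
def form (m n : ℕ) : Lat n →ₗ[ℤ] Lat n →ₗ[ℤ] ℤ :=
  LinearMap.mk₂ ℤ
    (fun x y => -((m : ℤ) - 2) * x 0 * y 0 + ∑ i : Fin n, x i.succ * y i.succ)
    (by intros; simp only [Pi.add_apply, add_mul, Finset.sum_add_distrib]; ring)
    (by intros; simp only [Pi.smul_apply, smul_eq_mul, mul_add, Finset.mul_sum, mul_assoc]; ring_nf)
    (by intros; simp only [Pi.add_apply, mul_add, Finset.sum_add_distrib]; ring)
    (by
      intro c x y
      simp only [Pi.smul_apply, smul_eq_mul, mul_add, Finset.mul_sum]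
      congr 1
      · ring
      · exact Finset.sum_congr rfl fun i _ => by ring)

/-- The simple roots `α₀ = e₀ - e₁ - ⋯ - eₘ` and `αᵢ = eᵢ - eᵢ₊₁` for `1 ≤ i ≤ n-1`. -/
def root (m n i : ℕ) : Lat n :=
  if i = 0 then e n 0 - ∑ j ∈ Finset.Icc 1 m, e n j else e n i - e n (i + 1)

theorem form_apply (m n : ℕ) (x y : Lat n) :
    form m n x y = -((m : ℤ) - 2) * x 0 * y 0 + ∑ i : Fin n, x i.succ * y i.succ := rfl

theorem form_e_zero (m n : ℕ) (y : Lat n) : form m n (e n 0) y = -((m : ℤ) - 2) * y 0 := by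
  simp [form_apply, e]

theorem form_e (m n : ℕ) (y : Lat n) (j : ℕ) (h1 : 1 ≤ j) (hn : j ≤ n) :
    form m n (e n j) y = y ⟨j, by omega⟩ := by
  obtain ⟨k, rfl⟩ : ∃ k, j = k + 1 := ⟨j - 1, by omega⟩
  have hk : k < n := by omega
  rw [form_apply, Finset.sum_eq_single (⟨k, hk⟩ : Fin n)]
  · simp [e, Fin.succ]
  · intro b _ hb
    have : (b : ℕ) ≠ k := fun h => hb (Fin.ext h)
    simp [e, this]
  · simp

theorem form_root_zero (m n : ℕ) (h : m < n) (y : Lat n) :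
    form m n (root m n 0) y = -((m : ℤ) - 2) * y 0 -
      ∑ j ∈ (Finset.Icc 1 m).attach, y ⟨j.1, by have := Finset.mem_Icc.1 j.2; omega⟩ := by
  rw [root, if_pos rfl, map_sub, LinearMap.sub_apply, form_e_zero, map_sum,
    LinearMap.sum_apply, ← Finset.sum_attach (Finset.Icc 1 m)]
  congr 1
  refine Finset.sum_congr rfl fun j _ => ?_
  have := Finset.mem_Icc.1 j.2
  exact form_e m n y j.1 this.1 (by omega)

theorem form_root_pos (m n i : ℕ) (hi : 1 ≤ i) (hin : i < n) (y : Lat n) :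
    form m n (root m n i) y = y ⟨i, by omega⟩ - y ⟨i + 1, by omega⟩ := by
  rw [root, if_neg (by omega), map_sub, LinearMap.sub_apply,
    form_e m n y i hi (by omega), form_e m n y (i + 1) (by omega) (by omega)]

theorem root_zero_apply (m n : ℕ) (k : Fin (n + 1)) :
    root m n 0 k = (if (k : ℕ) = 0 then 1 else 0) - (if 1 ≤ (k : ℕ) ∧ (k : ℕ) ≤ m then 1 else 0) := by
  rw [root, if_pos rfl, Pi.sub_apply, Finset.sum_apply]
  simp [e]

theorem form_root_self (m n i : ℕ) (h : m < n) (hi : i < n) :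
    form m n (root m n i) (root m n i) = 2 := by
  rcases Nat.eq_zero_or_pos i with rfl | hi'
  · rw [form_root_zero m n h, root_zero_apply]
    have : ∀ j ∈ (Finset.Icc 1 m).attach,
        root m n 0 ⟨j.1, by have := Finset.mem_Icc.1 j.2; omega⟩ = -1 := by
      intro j _
      have := Finset.mem_Icc.1 j.2
      rw [root_zero_apply, if_neg (by simp; omega), if_pos (by simpa using this)]
      norm_num
    rw [Finset.sum_congr rfl this]
    simp
  · rw [form_root_pos m n i hi' hi, root, if_neg (by omega)]
    simp [e]

/-- The simple reflection `sᵢ(L) = L - ⟨αᵢ, L⟩ αᵢ`, `0 ≤ i ≤ n-1`. -/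
def refl {m n : ℕ} (h : m < n) (i : ℕ) (hi : i < n) : Lat n ≃ₗ[ℤ] Lat n :=
  Module.reflection (form_root_self m n i h hi)

theorem refl_apply {m n : ℕ} (h : m < n) (i : ℕ) (hi : i < n) (L : Lat n) :
    refl h i hi L = L - form m n (root m n i) L • root m n i :=
  Module.reflection_apply _ _

/-- The Weyl group `W_{m,n}`, realised (faithfully) as the group of automorphisms of the lattice
generated by the simple reflections. -/
def W {m n : ℕ} (h : m < n) : Subgroup (Lat n ≃ₗ[ℤ] Lat n) :=
  Subgroup.closure {g | ∃ (i : ℕ) (hi : i < n), g = refl h i hi}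

/-- The simple reflection `sᵢ` as an element of the Weyl group. -/
def s {m n : ℕ} (h : m < n) (i : ℕ) (hi : i < n) : W h :=
  ⟨refl h i hi, Subgroup.subset_closure ⟨i, hi, rfl⟩⟩

/-- The Weyl group orbit `M = W_{m,n} . e₁`. -/
abbrev M {m n : ℕ} (h : m < n) : Set (Lat n) := MulAction.orbit (W h) (e n 1)

theorem s_smul {m n : ℕ} (h : m < n) (i : ℕ) (hi : i < n) (L : Lat n) :
    s h i hi • L = L - form m n (root m n i) L • root m n i :=
  refl_apply h i hi L

theorem smul_mem_M {m n : ℕ} {h : m < n} {L : Lat n} (w : W h) (hL : L ∈ M h) : w • L ∈ M h := by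
  obtain ⟨g, rfl⟩ := hL
  exact ⟨w * g, mul_smul _ _ _⟩

/-- The basis vectors `e₁, …, eₙ` belong to the orbit `M`. -/
theorem e_mem_M {m n : ℕ} (h : m < n) (i : ℕ) (h1 : 1 ≤ i) (hn : i ≤ n) : e n i ∈ M h := by
  induction i, h1 using Nat.le_induction with
  | base => exact MulAction.mem_orbit_self _
  | succ i h1 ih =>
    have := smul_mem_M (s h i (by omega)) (ih (by omega))
    rw [s_smul, form_root_pos m n i h1 (by omega)] at this
    convert this using 1
    rw [root, if_neg (by omega)]
    simp [e]

/-- `e₀` minus `m-1` distinct vectors among `e₁, …, eₙ` belongs to the orbit `M`. -/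
theorem e_zero_sub_sum_mem_M {m n : ℕ} (h : m < n) (T : Finset ℕ)
    (hT : T ⊆ Finset.Icc 1 n) (hc : T.card + 1 = m) : e n 0 - ∑ l ∈ T, e n l ∈ M h := by
  induction hN : ∑ l ∈ T, l using Nat.strong_induction_on generalizing T with
  | _ N ih =>
  by_cases hd : ∃ j, 1 ≤ j ∧ j + 1 ∈ T ∧ j ∉ T
  · obtain ⟨j, hj1, hjT, hj⟩ := hd
    have hjn := (Finset.mem_Icc.1 (hT hjT)).2
    set U := T.erase (j + 1) with hU
    have hjU : j ∉ U := fun hh => hj (Finset.mem_of_mem_erase hh)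
    have hj1U : j + 1 ∉ U := Finset.notMem_erase _ _
    have hTU : T = insert (j + 1) U := (Finset.insert_erase hjT).symm
    have hUT : U ⊆ Finset.Icc 1 n := (Finset.erase_subset _ _).trans hT
    have key : e n 0 - ∑ l ∈ insert j U, e n l ∈ M h := by
      refine ih (∑ l ∈ insert j U, l) ?_ (insert j U) ?_ ?_ rfl
      · rw [← hN, hTU, Finset.sum_insert hjU, Finset.sum_insert hj1U]; omega
      · exact Finset.insert_subset (Finset.mem_Icc.2 ⟨hj1, by omega⟩) hUT
      · rw [hTU, Finset.card_insert_of_notMem hj1U] at hc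
        rw [Finset.card_insert_of_notMem hjU, hc]
    have := smul_mem_M (s h j (by omega)) key
    convert this using 1
    rw [s_smul, form_root_pos m n j hj1 (by omega), hTU, Finset.sum_insert hjU,
      Finset.sum_insert hj1U, root, if_neg (by omega)]
    have v1 : (∑ l ∈ U, e n l) ⟨j, by omega⟩ = 0 := by
      rw [Finset.sum_apply]
      exact Finset.sum_eq_zero fun l hl => if_neg fun hh => hjU (by
        have hh : j = l := hh
        rwa [hh])
    have v2 : (∑ l ∈ U, e n l) ⟨j + 1, by omega⟩ = 0 := by
      rw [Finset.sum_apply]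
      exact Finset.sum_eq_zero fun l hl => if_neg fun hh => hj1U (by
        have hh : j + 1 = l := hh
        rwa [hh])
    have c : (e n 0 - (e n j + ∑ l ∈ U, e n l)) ⟨j, by omega⟩ -
        (e n 0 - (e n j + ∑ l ∈ U, e n l)) ⟨j + 1, by omega⟩ = -1 := by
      simp only [Pi.sub_apply, Pi.add_apply, v1, v2]
      have : j ≠ 0 := by omega
      simp [e, this]
    rw [c]
    module
  · push Not at hd
    have hdown : ∀ a b : ℕ, 1 ≤ b → a + b ∈ T → b ∈ T := by
      intro a
      induction a with
      | zero => intro b _ hb; simpa using hb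
      | succ a iha =>
        intro b hb hab
        exact hd b hb (iha (b + 1) (by omega) (by convert hab using 1; omega))
    have hsub : T ⊆ Finset.Icc 1 (m - 1) := by
      intro j hj
      have hj1 := (Finset.mem_Icc.1 (hT hj)).1
      have : Finset.Icc 1 j ⊆ T := by
        intro b hb
        have hb := Finset.mem_Icc.1 hb
        exact hdown (j - b) b hb.1 (by convert hj using 1; omega)
      have := Finset.card_le_card this
      rw [Nat.card_Icc] at this
      exact Finset.mem_Icc.2 ⟨hj1, by omega⟩
    have hTeq : T = Finset.Icc 1 (m - 1) :=
      Finset.eq_of_subset_of_card_le hsub (by rw [Nat.card_Icc]; omega)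
    have := smul_mem_M (s h 0 (by omega)) (e_mem_M h m (by omega) (by omega))
    convert this using 1
    have hval : form m n (root m n 0) (e n m) = -1 := by
      rw [form_apply]
      have hm0 : (0 : ℕ) ≠ m := by omega
      rw [Finset.sum_eq_single (⟨m - 1, by omega⟩ : Fin n)]
      · have : m - 1 + 1 = m := by omega
        simp [e, hm0, this, root_zero_apply]
        omega
      · intro b _ hb
        have : (b : ℕ) + 1 ≠ m := fun hh => hb (Fin.ext (by simp; omega))
        simp [e, this]
      · simp
    rw [s_smul, hval, root, if_pos rfl, hTeq]
    obtain ⟨k, rfl⟩ : ∃ k, m = k + 1 := ⟨m - 1, by omega⟩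
    rw [Finset.sum_Icc_succ_top (by omega), Nat.add_sub_cancel]
    module

/-! ### Entire and meromorphic functions of `(ε₀, …, εₙ)`, and the odd theta function -/

/-- The ring of entire functions of the `n+1` complex variables `(ε₀, …, εₙ)`. -/
def Entire (n : ℕ) : Subring ((Fin (n + 1) → ℂ) → ℂ) where
  carrier := {g | AnalyticOnNhd ℂ g Set.univ}
  mul_mem' ha hb := ha.mul hb
  one_mem' := analyticOnNhd_const
  add_mem' ha hb := ha.add hb
  zero_mem' := analyticOnNhd_const
  neg_mem' ha := ha.neg

instance (n : ℕ) : NoZeroDivisors (Entire n) where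
  eq_zero_or_eq_zero_of_mul_eq_zero := by
    rintro ⟨f, hf⟩ ⟨g, hg⟩ hfg
    by_contra! hne
    obtain ⟨hf0, hg0⟩ := hne
    have hgx : ∃ x, g x ≠ 0 := by
      by_contra! hh
      exact hg0 (Subtype.ext (funext hh))
    obtain ⟨x, hx⟩ := hgx
    have hcont : ContinuousAt g x := (hg x (Set.mem_univ x)).continuousAt
    have hev : f =ᶠ[nhds x] 0 := by
      filter_upwards [hcont.eventually_ne hx] with y hy
      have : f y * g y = 0 := congrFun (congrArg Subtype.val hfg) y
      exact (mul_eq_zero.1 this).resolve_right hy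
    have := hf.eqOn_zero_of_preconnected_of_eventuallyEq_zero isPreconnected_univ
      (Set.mem_univ x) hev
    exact hf0 (Subtype.ext (funext fun y => this (Set.mem_univ y)))

instance (n : ℕ) : IsDomain (Entire n) := NoZeroDivisors.to_isDomain _

/-- The field `K` of meromorphic functions on `ℂⁿ⁺¹` in the variables `(ε₀, …, εₙ)`: every such
function is a quotient of two entire functions. -/
abbrev K (n : ℕ) : Type := FractionRing (Entire n)

/-- The linear form `∑ Λᵢ εᵢ` attached to the lattice vector `Λ = ∑ Λᵢ eᵢ`. -/
def lin {n : ℕ} (Λ : Lat n) (ε : Fin (n + 1) → ℂ) : ℂ := ∑ i, (Λ i : ℂ) * ε i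

theorem analyticOnNhd_lin {n : ℕ} (Λ : Lat n) : AnalyticOnNhd ℂ (lin Λ) Set.univ := by
  have : lin Λ = fun ε => ∑ i, (Λ i : ℂ) * (ContinuousLinearMap.proj (R := ℂ) i) ε := rfl
  rw [this]
  refine Finset.analyticOnNhd_fun_sum _ fun i _ => ?_
  exact analyticOnNhd_const.mul (ContinuousLinearMap.analyticOnNhd _ _)

/-- The substitution of variables `εᵢ ↦ ∑ⱼ (w eᵢ)ⱼ εⱼ` induced by a lattice automorphism `w`. -/
def subst {n : ℕ} (w : Lat n ≃ₗ[ℤ] Lat n) (ε : Fin (n + 1) → ℂ) : Fin (n + 1) → ℂ :=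
  fun i => lin (w (e n i)) ε

theorem sum_smul_e {n : ℕ} (Λ : Lat n) : Λ = ∑ i : Fin (n + 1), Λ i • e n i := by
  funext k
  simp [Finset.sum_apply, e, ← Fin.ext_iff]

theorem lin_subst {n : ℕ} (w : Lat n ≃ₗ[ℤ] Lat n) (Λ : Lat n) (ε : Fin (n + 1) → ℂ) :
    lin Λ (subst w ε) = lin (w Λ) ε := by
  conv_rhs => rw [sum_smul_e Λ, map_sum]
  simp only [lin, subst, map_smul, Finset.sum_apply, Pi.smul_apply, smul_eq_mul, Int.cast_sum,
    Int.cast_mul, Finset.sum_mul, Finset.mul_sum]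
  rw [Finset.sum_comm]
  exact Finset.sum_congr rfl fun _ _ => Finset.sum_congr rfl fun _ _ => by ring

theorem subst_subst {n : ℕ} (w w' : Lat n ≃ₗ[ℤ] Lat n) (ε : Fin (n + 1) → ℂ) :
    subst w' (subst w ε) = subst (w * w') ε := by
  funext i
  exact lin_subst w _ ε

theorem subst_one {n : ℕ} (ε : Fin (n + 1) → ℂ) : subst 1 ε = ε := by
  funext i
  simp [subst, lin, e, ← Fin.ext_iff]

theorem analyticOnNhd_subst {n : ℕ} (w : Lat n ≃ₗ[ℤ] Lat n) :
    AnalyticOnNhd ℂ (subst w) Set.univ :=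
  analyticOnNhd_pi_iff.2 fun _ => analyticOnNhd_lin _

/-- The action of a lattice automorphism on entire functions: `w` sends the function `εᵢ` to the
linear form attached to `w eᵢ`. -/
def entireAct {n : ℕ} (w : Lat n ≃ₗ[ℤ] Lat n) : Entire n ≃+* Entire n where
  toFun g := ⟨fun ε => g.1 (subst w ε), fun x _ =>
    (g.2 _ (Set.mem_univ _)).comp (analyticOnNhd_subst w x (Set.mem_univ x))⟩
  invFun g := ⟨fun ε => g.1 (subst w⁻¹ ε), fun x _ =>
    (g.2 _ (Set.mem_univ _)).comp (analyticOnNhd_subst w⁻¹ x (Set.mem_univ x))⟩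
  left_inv g := Subtype.ext (funext fun ε => by
    simp only [subst_subst, inv_mul_cancel, subst_one])
  right_inv g := Subtype.ext (funext fun ε => by
    simp only [subst_subst, mul_inv_cancel, subst_one])
  map_mul' _ _ := rfl
  map_add' _ _ := rfl

/-- The induced action on meromorphic functions. -/
def kAct {n : ℕ} (w : Lat n ≃ₗ[ℤ] Lat n) : K n ≃+* K n :=
  IsFractionRing.ringEquivOfRingEquiv (entireAct w)

/-- The odd theta function `ϑ₁₁(z) = ∑ₖ exp(πi (k+1/2)² q + 2πi (k+1/2)(z+1/2))` with modulus
`q` in the upper half plane. -/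
def theta11 (q : ℍ) (z : ℂ) : ℂ :=
  ∑' k : ℤ, Complex.exp (Real.pi * Complex.I * ((k : ℂ) + 1 / 2) ^ 2 * (q : ℂ) +
    2 * Real.pi * Complex.I * ((k : ℂ) + 1 / 2) * (z + 1 / 2))

theorem theta11_eq (q : ℍ) (z : ℂ) : theta11 q z =
    Complex.exp (Real.pi * Complex.I * (q : ℂ) / 4 + Real.pi * Complex.I * (z + 1 / 2)) *
      jacobiTheta₂ (z + 1 / 2 + (q : ℂ) / 2) q := by
  rw [theta11, jacobiTheta₂, ← tsum_mul_left]
  refine tsum_congr fun k => ?_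
  rw [jacobiTheta₂_term, ← Complex.exp_add]
  congr 1
  ring

theorem differentiable_theta11 (q : ℍ) : Differentiable ℂ (theta11 q) := by
  have : theta11 q = fun z => _ := funext (theta11_eq q)
  rw [this]
  refine Differentiable.mul (by fun_prop) fun z => ?_
  exact DifferentiableAt.comp (g := fun x => jacobiTheta₂ x (q : ℂ))
    (f := fun z : ℂ => z + 1 / 2 + (q : ℂ) / 2) z
    (differentiableAt_jacobiTheta₂_fst (z + 1 / 2 + (q : ℂ) / 2) q.im_pos) (by fun_prop)

/-- The element `[Λ] = ϑ₁₁(∑ Λᵢ εᵢ)` of `K`, for a lattice vector `Λ`. For instance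
`[εᵢ - εⱼ]` is `br q (e n i - e n j)`. -/
def br {n : ℕ} (q : ℍ) (Λ : Lat n) : K n :=
  algebraMap (Entire n) (K n) ⟨fun ε => theta11 q (lin Λ ε), fun x _ =>
    ((differentiable_theta11 q).analyticAt _).comp (analyticOnNhd_lin Λ x (Set.mem_univ x))⟩

/-- The coefficient
`c_{i,j} = [εᵢ - εₘ₊₁] [α₀ + εⱼ - εₘ₊₁] / ([εᵢ - εⱼ] [α₀])`. -/
def c (m n : ℕ) (q : ℍ) (i j : ℕ) : K n :=
  (br q (e n i - e n (m + 1)) * br q (root m n 0 + e n j - e n (m + 1))) /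
    (br q (e n i - e n j) * br q (root m n 0))

/-! ### Families of `τ` functions -/

/-- The vector `eᵢ`, `1 ≤ i ≤ n`, as a point of the orbit. -/
def pt {m n : ℕ} (h : m < n) (i : ℕ) (h1 : 1 ≤ i) (hn : i ≤ n) : M h := ⟨e n i, e_mem_M h i h1 hn⟩

section families

variable {m n : ℕ} {h : m < n} {F : Type*} [CommRing F]

/-- `τᵢ = τ(eᵢ)` for `1 ≤ i ≤ n`. -/
def tau (t : M h → Fˣ) (i : ℕ) (h1 : 1 ≤ i) (hn : i ≤ n) : Fˣ := t (pt h i h1 hn)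

/-- `fᵢ = τ(s₀ . eᵢ) / τ(eᵢ)` (used for `1 ≤ i ≤ m`). -/
def f (t : M h → Fˣ) (i : ℕ) (h1 : 1 ≤ i) (hn : i ≤ n) : Fˣ :=
  t (s h 0 (by omega) • pt h i h1 hn) / t (pt h i h1 hn)

/-- `ρ` is the action of the Weyl group on the functions that comes from its action on `M` and on
the variables `εᵢ`: one has `w(a) = w . a` for the coefficients `a ∈ K`, and
`w(τ(Λ)) = τ(w . Λ)`. -/
structure ActsThroughOrbit (κ : K n →+* F) (t : M h → Fˣ) (ρ : W h →* (F ≃+* F)) : Prop where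
  coeff : ∀ (w : W h) (a : K n), ρ w (κ a) = κ (kAct (w : Lat n ≃ₗ[ℤ] Lat n) a)
  tau : ∀ (w : W h) (Λ : M h), ρ w (t Λ) = t (w • Λ)

/-- The simple reflections act on the variables `τ₁, …, τₙ` and `f₁, …, fₘ` by the birational
transformations. -/
structure BirationalTransformations (q : ℍ) (κ : K n →+* F) (t : M h → Fˣ)
    (ρ : W h →* (F ≃+* F)) : Prop where
  /-- `s₀(τᵢ) = fᵢ τᵢ` for `1 ≤ i ≤ m` -/
  s_zero_tau : ∀ (i : ℕ) (h1 : 1 ≤ i) (hm : i ≤ m),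
    ρ (s h 0 (by omega)) (tau t i h1 (by omega)) = f t i h1 (by omega) * tau t i h1 (by omega)
  /-- `s₀(τⱼ) = τⱼ` for `m+1 ≤ j ≤ n` -/
  s_zero_tau_fix : ∀ (j : ℕ) (hm : m + 1 ≤ j) (hn : j ≤ n),
    ρ (s h 0 (by omega)) (tau t j (by omega) hn) = tau t j (by omega) hn
  /-- `sᵢ(τᵢ) = τᵢ₊₁` for `1 ≤ i ≤ n-1` -/
  s_tau_left : ∀ (i : ℕ) (h1 : 1 ≤ i) (hn : i < n),
    ρ (s h i hn) (tau t i h1 (by omega)) = tau t (i + 1) (by omega) hn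
  /-- `sᵢ(τᵢ₊₁) = τᵢ` for `1 ≤ i ≤ n-1` -/
  s_tau_right : ∀ (i : ℕ) (h1 : 1 ≤ i) (hn : i < n),
    ρ (s h i hn) (tau t (i + 1) (by omega) hn) = tau t i h1 (by omega)
  /-- `sᵢ(τⱼ) = τⱼ` for `1 ≤ i ≤ n-1` and `j ≠ i, i+1` -/
  s_tau_fix : ∀ (i j : ℕ) (_ : 1 ≤ i) (hn : i < n) (hj1 : 1 ≤ j) (hjn : j ≤ n),
    j ≠ i → j ≠ i + 1 → ρ (s h i hn) (tau t j hj1 hjn) = tau t j hj1 hjn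
  /-- `s₀(fᵢ) = 1 / fᵢ` for `1 ≤ i ≤ m` -/
  s_zero_f : ∀ (i : ℕ) (h1 : 1 ≤ i) (hm : i ≤ m),
    ρ (s h 0 (by omega)) (f t i h1 (by omega)) = ((f t i h1 (by omega))⁻¹ : Fˣ)
  /-- `sᵢ(fᵢ) = fᵢ₊₁` for `1 ≤ i ≤ m-1` -/
  s_f_left : ∀ (i : ℕ) (h1 : 1 ≤ i) (hm : i < m),
    ρ (s h i (by omega)) (f t i h1 (by omega)) = f t (i + 1) (by omega) (by omega)
  /-- `sᵢ(fᵢ₊₁) = fᵢ` for `1 ≤ i ≤ m-1` -/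
  s_f_right : ∀ (i : ℕ) (h1 : 1 ≤ i) (hm : i < m),
    ρ (s h i (by omega)) (f t (i + 1) (by omega) (by omega)) = f t i h1 (by omega)
  /-- `sₘ(fᵢ) = (τₘ / τₘ₊₁) (c_{i,m} fᵢ + c_{m,i} fₘ)` for `1 ≤ i ≤ m-1` -/
  s_m_f : ∀ (i : ℕ) (h1 : 1 ≤ i) (hm : i < m),
    ρ (s h m h) (f t i h1 (by omega)) =
      (tau t m (by omega) (by omega) / tau t (m + 1) (by omega) h : Fˣ) *
        (κ (c m n q i m) * f t i h1 (by omega) + κ (c m n q m i) * f t m (by omega) (by omega))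
  /-- `sₘ(fₘ) = (τₘ / τₘ₊₁) fₘ` -/
  s_m_f_m : ∀ (hm : 1 ≤ m),
    ρ (s h m h) (f t m hm (by omega)) =
      (tau t m hm (by omega) / tau t (m + 1) (by omega) h : Fˣ) * f t m hm (by omega)
  /-- `sᵢ(fⱼ) = fⱼ` for `1 ≤ i ≤ n-1`, `i ≠ m` and `1 ≤ j ≤ m`, `j ≠ i, i+1` -/
  s_f_fix : ∀ (i j : ℕ) (_ : 1 ≤ i) (hn : i < n) (hj1 : 1 ≤ j) (hjm : j ≤ m),
    i ≠ m → j ≠ i → j ≠ i + 1 →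
      ρ (s h i hn) (f t j hj1 (by omega)) = f t j hj1 (by omega)

/-- The vector `L = e₀ - e_{l₁} - ⋯ - e_{l_{m-2}}` attached to the set `S = {l₁, …, l_{m-2}}`. -/
def vecL (n : ℕ) (S : Finset ℕ) : Lat n := e n 0 - ∑ l ∈ S, e n l

theorem vecL_sub_mem_M (h : m < n) (S : Finset ℕ) (hS : S ⊆ Finset.Icc 1 n) (hc : S.card + 2 = m)
    (i : ℕ) (hi : i ∈ Finset.Icc 1 n) (hiS : i ∉ S) : vecL n S - e n i ∈ M h := by
  have := e_zero_sub_sum_mem_M h (insert i S) (Finset.insert_subset hi hS)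
    (by rw [Finset.card_insert_of_notMem hiS]; omega)
  rw [Finset.sum_insert hiS] at this
  convert this using 1
  rw [vecL]
  abel

/-- The point `L - eᵢ` of the orbit. -/
def ptL (h : m < n) (S : Finset ℕ) (hS : S ⊆ Finset.Icc 1 n) (hc : S.card + 2 = m)
    (i : ℕ) (hi : i ∈ Finset.Icc 1 n) (hiS : i ∉ S) : M h :=
  ⟨vecL n S - e n i, vecL_sub_mem_M h S hS hc i hi hiS⟩

/-- The bilinear relations: for mutually distinct indices `i, j, k, l₁, …, l_{m-2}` in
`{1, …, n}` and `L = e₀ - e_{l₁} - ⋯ - e_{l_{m-2}}`,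
`[εⱼ-εₖ][L-εⱼ-εₖ] τ(eᵢ) τ(L-eᵢ) + [εₖ-εᵢ][L-εₖ-εᵢ] τ(eⱼ) τ(L-eⱼ)
  + [εᵢ-εⱼ][L-εᵢ-εⱼ] τ(eₖ) τ(L-eₖ) = 0`. -/
def BilinearRelations (q : ℍ) (κ : K n →+* F) (t : M h → Fˣ) : Prop :=
  ∀ (S : Finset ℕ) (hS : S ⊆ Finset.Icc 1 n) (hc : S.card + 2 = m)
    (i j k : ℕ) (hi : i ∈ Finset.Icc 1 n) (hj : j ∈ Finset.Icc 1 n) (hk : k ∈ Finset.Icc 1 n)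
    (hiS : i ∉ S) (hjS : j ∉ S) (hkS : k ∉ S), i ≠ j → j ≠ k → k ≠ i →
    κ (br q (e n j - e n k) * br q (vecL n S - e n j - e n k)) *
        (t ⟨e n i, e_mem_M h i (Finset.mem_Icc.1 hi).1 (Finset.mem_Icc.1 hi).2⟩ *
          t (ptL h S hS hc i hi hiS)) +
      κ (br q (e n k - e n i) * br q (vecL n S - e n k - e n i)) *
        (t ⟨e n j, e_mem_M h j (Finset.mem_Icc.1 hj).1 (Finset.mem_Icc.1 hj).2⟩ *
          t (ptL h S hS hc j hj hjS)) +
      κ (br q (e n i - e n j) * br q (vecL n S - e n i - e n j)) *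
        (t ⟨e n k, e_mem_M h k (Finset.mem_Icc.1 hk).1 (Finset.mem_Icc.1 hk).2⟩ *
          t (ptL h S hS hc k hk hkS)) = 0

end families

universe u

/-- For an arbitrary family `τ(Λ)` of functions, on which the Weyl group is not assumed to act:
the action of the Weyl group on `M` is consistent with the birational transformations if the family
is a specialisation (the image under a homomorphism `φ` of `K`-algebras) of a family on which the
Weyl group acts by `w(T(Λ)) = T(w . Λ)` and by the birational transformations. -/
def Consistent {m n : ℕ} {h : m < n} {F : Type u} [CommRing F] (q : ℍ) (κ : K n →+* F)
    (t : M h → Fˣ) : Prop :=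
  ∃ (A : Type u) (_ : CommRing A) (κA : K n →+* A) (T : M h → Aˣ) (ρ : W h →* (A ≃+* A))
    (φ : A →+* F), ActsThroughOrbit κA T ρ ∧ BirationalTransformations q κA T ρ ∧
      φ.comp κA = κ ∧ ∀ Λ, φ (T Λ) = t Λ

end

end EllTau

namespace EllTau

/-! ### The odd theta function -/

/-! Once `W` acts through the orbit, every `τ(w.Λ)` is prescribed, so each birational transformation
becomes an identity between values of `τ`. All but one type are automatic: they only say where `s_i`
sends `e_j` and `s₀.e_j`. The exception is `s_m(f_i)` with `i < m`. For `S = {1,…,m-1} \ {i}` and `L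
= e₀ - ∑_{l ∈ S} e_l` one has `s₀.e_i = L - e_m`, `s₀.e_m = L - e_i`, `s_m s₀.e_i = L - e_{m+1}` and
`α₀ = L - e_i - e_m`. Clearing the denominators turns the formula for `s_m(f_i)` into the bilinear
relation for `S` and `(i, m, m+1)`; this is `bilinearForm_eq_zero_iff`. It uses only that the
bracket is odd and not identically zero, never the three-term theta identity.

A general bilinear relation is the image of such a special one under an element of `W` permuting
`e₁,…,eₙ` (`exists_permutes_configuration`, `map_bilinearForm`). This gives (i),
`birationalTransformations_iff`.

For (ii), a consistent family inherits all transforms of the relations by applying `w` in `A` and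
then mapping to `F`. Conversely, the coinduced algebra of functions `W → F`, with `T(Λ) = (w ↦
τ(w.Λ))`, carries an action of `W` by right translation, and evaluation at `1` recovers `τ`. The
relations for `T`, read at the component `w`, are exactly the `w`-transforms of those for `τ`, so
(i) applies to `T`. -/

theorem theta11_neg (q : ℍ) (z : ℂ) : theta11 q (-z) = -theta11 q z := by
  rw [theta11, theta11, ← tsum_neg]
  -- The reindexing `k ↦ -1 - k` changes the sign of `k + 1/2`. The square is unchanged, and the
  -- shift by `1/2` in the linear term leaves the factor `exp(-2πi(k + 1/2)) = -1`.
  rw [← (Equiv.subLeft (-1 : ℤ)).tsum_eq]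
  refine tsum_congr fun k => ?_
  have hk : Complex.exp (-(2 * Real.pi * Complex.I * ((k : ℂ) + 1 / 2))) = -1 := by
    rw [show -(2 * (Real.pi : ℂ) * Complex.I * ((k : ℂ) + 1 / 2)) =
      ((-(k + 1) : ℤ) : ℂ) * (2 * Real.pi * Complex.I) + Real.pi * Complex.I by push_cast; ring,
      Complex.exp_add, Complex.exp_int_mul_two_pi_mul_I, Complex.exp_pi_mul_I, one_mul]
  rw [neg_eq_neg_one_mul (Complex.exp _), ← hk, ← Complex.exp_add]
  congr 1
  simp only [Equiv.subLeft_apply, Int.cast_sub, Int.cast_neg, Int.cast_one]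
  ring

theorem integral_jacobiTheta₂_term (k : ℤ) (τ : ℂ) :
    ∫ x in (0 : ℝ)..1, jacobiTheta₂_term k x τ = if k = 0 then 1 else 0 := by
  split_ifs with hk
  · simp [hk, jacobiTheta₂_term]
  · have hc : 2 * (Real.pi : ℂ) * Complex.I * k ≠ 0 := by
      simp [hk, Real.pi_ne_zero]
    simp only [jacobiTheta₂_term, Complex.exp_add, intervalIntegral.integral_mul_const]
    rw [integral_exp_mul_complex hc]
    have : Complex.exp (2 * Real.pi * Complex.I * k) = 1 := by
      rw [mul_comm, Complex.exp_int_mul_two_pi_mul_I]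
    simp [this]

/-- The integral over a period extracts the constant Fourier coefficient, which is `1`; hence the
theta function cannot vanish identically. On the real axis each term has constant norm, so dominated
convergence applies. -/
theorem integral_jacobiTheta₂ {τ : ℂ} (hτ : 0 < τ.im) :
    ∫ x in (0 : ℝ)..1, jacobiTheta₂ x τ = 1 := by
  have key : HasSum (fun k : ℤ => ∫ x in (0 : ℝ)..1, jacobiTheta₂_term k x τ)
      (∫ x in (0 : ℝ)..1, jacobiTheta₂ x τ) := by
    refine intervalIntegral.hasSum_integral_of_dominated_convergence
      (fun k _ => ‖jacobiTheta₂_term k 0 τ‖) (fun k => ?_) (fun k => ?_) ?_ ?_ ?_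
    · refine Continuous.aestronglyMeasurable ?_
      unfold jacobiTheta₂_term
      fun_prop
    · exact .of_forall fun x _ => by simp [norm_jacobiTheta₂_term]
    · exact .of_forall fun x _ => ((summable_jacobiTheta₂_term_iff 0 τ).2 hτ).norm
    · exact intervalIntegrable_const
    · exact .of_forall fun x _ => hasSum_jacobiTheta₂_term x hτ
  simp only [integral_jacobiTheta₂_term] at key
  exact key.unique (hasSum_ite_eq 0 1)

theorem exists_theta11_ne_zero (q : ℍ) : ∃ z, theta11 q z ≠ 0 := by
  by_contra! hh
  have : ∀ x : ℂ, jacobiTheta₂ x q = 0 := fun x => by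
    have := hh (x - 1 / 2 - (q : ℂ) / 2)
    rw [theta11_eq] at this
    convert (mul_eq_zero.1 this).resolve_left (Complex.exp_ne_zero _) using 2
    ring
  have h1 := integral_jacobiTheta₂ q.im_pos
  simp [this] at h1

/-! ### The brackets in the field of meromorphic functions -/

theorem lin_surjective {n : ℕ} {Λ : Lat n} (hΛ : Λ ≠ 0) : Function.Surjective (lin Λ) := by
  obtain ⟨i, hi⟩ := Function.ne_iff.1 hΛ
  have hi' : (Λ i : ℂ) ≠ 0 := by simpa using hi
  intro z
  refine ⟨Pi.single i (z / Λ i), ?_⟩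
  rw [lin, Finset.sum_eq_single i]
  · rw [Pi.single_eq_same, mul_div_cancel₀ _ hi']
  · intro j _ hj
    rw [Pi.single_eq_of_ne hj, mul_zero]
  · simp

theorem lin_neg {n : ℕ} (Λ : Lat n) (ε : Fin (n + 1) → ℂ) : lin (-Λ) ε = -lin Λ ε := by
  simp [lin]

theorem br_neg {n : ℕ} (q : ℍ) (Λ : Lat n) : br q (-Λ) = -br q Λ := by
  rw [br, br, ← map_neg]
  congr 1
  refine Subtype.ext (funext fun ε => ?_)
  change theta11 q (lin (-Λ) ε) = -theta11 q (lin Λ ε)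
  rw [lin_neg, theta11_neg]

theorem br_sub_comm {n : ℕ} (q : ℍ) (Λ Λ' : Lat n) : br q (Λ - Λ') = -br q (Λ' - Λ) := by
  rw [← br_neg, neg_sub]

/-- A nonzero linear form takes every complex value, in particular one at which theta does not
vanish. This makes the denominators of the `c_{i,j}` with `i ≠ j` genuine. -/
theorem br_ne_zero {n : ℕ} (q : ℍ) {Λ : Lat n} (hΛ : Λ ≠ 0) : br q Λ ≠ 0 := by
  rw [br, Ne, map_eq_zero_iff _ (IsFractionRing.injective (Entire n) (K n))]
  intro h0
  obtain ⟨z, hz⟩ := exists_theta11_ne_zero q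
  obtain ⟨ε, rfl⟩ := lin_surjective hΛ z
  exact hz (congrFun (congrArg Subtype.val h0) ε)

theorem kAct_br {n : ℕ} (q : ℍ) (w : Lat n ≃ₗ[ℤ] Lat n) (Λ : Lat n) :
    kAct w (br q Λ) = br q (w Λ) := by
  rw [kAct, br, IsFractionRing.ringEquivOfRingEquiv_algebraMap, br]
  congr 1
  refine Subtype.ext (funext fun ε => ?_)
  change theta11 q (lin Λ (subst w ε)) = theta11 q (lin (w Λ) ε)
  rw [lin_subst]

theorem kAct_one {n : ℕ} (a : K n) : kAct 1 a = a := by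
  have : entireAct (1 : Lat n ≃ₗ[ℤ] Lat n) = .refl _ :=
    RingEquiv.ext fun g => Subtype.ext (funext fun ε => congrArg g.1 (subst_one ε))
  rw [kAct, this, IsFractionRing.ringEquivOfRingEquiv_refl, RingEquiv.refl_apply]

theorem kAct_mul {n : ℕ} (w w' : Lat n ≃ₗ[ℤ] Lat n) (a : K n) :
    kAct (w * w') a = kAct w (kAct w' a) := by
  have : entireAct (w * w') = (entireAct w').trans (entireAct w) :=
    RingEquiv.ext fun g => Subtype.ext (funext fun ε => congrArg g.1 (subst_subst w w' ε).symm)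
  rw [kAct, this, IsFractionRing.ringEquivOfRingEquiv_comp (K n) (K n) (K n)]
  rfl

/-! ### Permutations of `e₁, …, eₙ` in the Weyl group -/

theorem e_apply {n : ℕ} (i : ℕ) (k : Fin (n + 1)) : e n i k = if (k : ℕ) = i then 1 else 0 := rfl

theorem s_smul_e {m n : ℕ} (h : m < n) (i : ℕ) (hi : 1 ≤ i) (hn : i < n) (j : ℕ) :
    s h i hn • e n j = e n (Equiv.swap i (i + 1) j) := by
  rw [s_smul, form_root_pos m n i hi hn, root, if_neg (by omega), e_apply, e_apply]
  rcases eq_or_ne j i with rfl | hji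
  · simp
  rcases eq_or_ne j (i + 1) with rfl | hji'
  · simp
  · rw [Equiv.swap_apply_of_ne_of_ne hji hji', if_neg (Ne.symm hji), if_neg (Ne.symm hji')]
    simp

/-- `w` permutes the basis vectors by `σ`. -/
def Permutes {m n : ℕ} {h : m < n} (w : W h) (σ : Equiv.Perm ℕ) : Prop :=
  ∀ j, w • e n j = e n (σ j)

/-- The permutations of the indices `1, …, n` that are realised in the Weyl group. -/
def permSubgroup {m n : ℕ} (h : m < n) : Subgroup (Equiv.Perm ℕ) where
  carrier := {σ | (∀ j, j ∈ Finset.Icc 1 n ↔ σ j ∈ Finset.Icc 1 n) ∧ σ 0 = 0 ∧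
    ∃ w : W h, Permutes w σ}
  mul_mem' := by
    rintro σ σ' ⟨h1, h2, w, hw⟩ ⟨h1', h2', w', hw'⟩
    refine ⟨fun j => (h1' j).trans (h1 _), by simp [h2, h2'], w * w', fun j => ?_⟩
    rw [mul_smul, hw', hw, Equiv.Perm.mul_apply]
  one_mem' := ⟨fun _ => Iff.rfl, rfl, 1, fun j => one_smul _ _⟩
  inv_mem' := by
    rintro σ ⟨h1, h2, w, hw⟩
    refine ⟨fun j => ?_, ?_, w⁻¹, fun j => ?_⟩
    · rw [h1 (σ⁻¹ j), ← Equiv.Perm.mul_apply, mul_inv_cancel, Equiv.Perm.one_apply]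
    · rw [Equiv.Perm.inv_eq_iff_eq, h2]
    · rw [inv_smul_eq_iff, hw, ← Equiv.Perm.mul_apply, mul_inv_cancel, Equiv.Perm.one_apply]

theorem swap_succ_mem_permSubgroup {m n : ℕ} (h : m < n) (i : ℕ) (hi : 1 ≤ i) (hn : i < n) :
    Equiv.swap i (i + 1) ∈ permSubgroup h := by
  refine ⟨fun j => ?_, Equiv.swap_apply_of_ne_of_ne (by omega) (by omega), s h i hn,
    s_smul_e h i hi hn⟩
  simp only [Finset.mem_Icc, Equiv.swap_apply_def]
  split_ifs <;> omega

theorem swap_mem_permSubgroup {m n : ℕ} (h : m < n) {a b : ℕ} (ha : a ∈ Finset.Icc 1 n)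
    (hb : b ∈ Finset.Icc 1 n) : Equiv.swap a b ∈ permSubgroup h := by
  wlog hab : a ≤ b generalizing a b
  · rw [Equiv.swap_comm]
    exact this hb ha (by omega)
  have ha1 := (Finset.mem_Icc.1 ha).1
  have hbn := (Finset.mem_Icc.1 hb).2
  clear ha hb
  induction b, hab using Nat.le_induction with
  | base => rw [Equiv.swap_self]; exact one_mem _
  | succ b hab ih =>
    have hs := swap_succ_mem_permSubgroup h b (by omega) (by omega)
    rcases hab.eq_or_lt with rfl | hlt
    · exact hs
    -- Conjugating the transposition `(a b)` by `(b b+1)` gives `(a b+1)`.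
    · have := mul_mem (mul_mem hs (ih (by omega))) hs
      rwa [Equiv.swap_mul_swap_mul_swap (by omega) (by omega), Equiv.swap_comm] at this

theorem exists_permSubgroup_apply_eq {m n : ℕ} (h : m < n) {r : ℕ} (y y' : Fin r → ℕ)
    (hy : Function.Injective y) (hy' : Function.Injective y')
    (hyn : ∀ t, y t ∈ Finset.Icc 1 n) (hyn' : ∀ t, y' t ∈ Finset.Icc 1 n) :
    ∃ σ ∈ permSubgroup h, ∀ t, σ (y t) = y' t := by
  induction r with
  | zero => exact ⟨1, one_mem _, fun t => t.elim0⟩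
  | succ r ih =>
    obtain ⟨σ, hσ, hσy⟩ := ih (fun t => y t.succ) (fun t => y' t.succ)
      (hy.comp (Fin.succ_injective r)) (hy'.comp (Fin.succ_injective r))
      (fun t => hyn _) (fun t => hyn' _)
    -- With the tail already matched by `σ`, one transposition corrects the head. By injectivity of
    -- `y` and `y'` it moves none of the tail values.
    refine ⟨Equiv.swap (σ (y 0)) (y' 0) * σ,
      mul_mem (swap_mem_permSubgroup h ((hσ.1 _).1 (hyn 0)) (hyn' 0)) hσ, fun t => ?_⟩
    rw [Equiv.Perm.mul_apply]
    refine Fin.cases ?_ (fun t => ?_) t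
    · rw [Equiv.swap_apply_left]
    · rw [hσy, Equiv.swap_apply_of_ne_of_ne]
      · rw [← hσy]
        exact fun hh => Fin.succ_ne_zero t (hy (σ.injective hh))
      · exact fun hh => Fin.succ_ne_zero t (hy' hh)

theorem smul_vecL {m n : ℕ} {h : m < n} {w : W h} {σ : Equiv.Perm ℕ} (hw : Permutes w σ)
    (h0 : σ 0 = 0) (S : Finset ℕ) : w • vecL n S = vecL n (S.image σ) := by
  rw [vecL, smul_sub, Finset.smul_sum, hw, h0, vecL, Finset.sum_image σ.injective.injOn]
  simp only [hw _]

/-- Any two configurations of mutually distinct indices `i, j, k, l₁, …` are conjugate. -/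
theorem exists_permutes_configuration {m n : ℕ} (h : m < n) {r : ℕ} {S S' : Finset ℕ}
    (hS : S ⊆ Finset.Icc 1 n) (hS' : S' ⊆ Finset.Icc 1 n) (hc : S.card = r) (hc' : S'.card = r)
    {i j k i' j' k' : ℕ}
    (hi : i ∈ Finset.Icc 1 n) (hj : j ∈ Finset.Icc 1 n) (hk : k ∈ Finset.Icc 1 n)
    (hiS : i ∉ S) (hjS : j ∉ S) (hkS : k ∉ S) (hij : i ≠ j) (hjk : j ≠ k) (hki : k ≠ i)
    (hi' : i' ∈ Finset.Icc 1 n) (hj' : j' ∈ Finset.Icc 1 n) (hk' : k' ∈ Finset.Icc 1 n)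
    (hiS' : i' ∉ S') (hjS' : j' ∉ S') (hkS' : k' ∉ S')
    (hij' : i' ≠ j') (hjk' : j' ≠ k') (hki' : k' ≠ i') :
    ∃ (w : W h) (σ : Equiv.Perm ℕ), Permutes w σ ∧ σ 0 = 0 ∧ S.image σ = S' ∧
      σ i = i' ∧ σ j = j' ∧ σ k = k' := by
  -- A configuration is encoded as an injective `(r+3)`-tuple: the three indices followed by the
  -- increasing enumeration of the set. Multiple transitivity then matches the two tuples.
  have inj : ∀ {T : Finset ℕ} (hT : T.card = r) {a b d : ℕ}, a ∉ T → b ∉ T → d ∉ T →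
      a ≠ b → b ≠ d → d ≠ a → Function.Injective
        (Fin.cons a (Fin.cons b (Fin.cons d (T.orderEmbOfFin hT))) : Fin (r + 3) → ℕ) := by
    intro T hT a b d ha hb hd hab hbd hda
    simp only [Fin.cons_injective_iff, Fin.range_cons, Finset.range_orderEmbOfFin,
      Set.mem_insert_iff, Finset.mem_coe, not_or]
    exact ⟨⟨hab, hda.symm, ha⟩, ⟨hbd, hb⟩, hd, (T.orderEmbOfFin hT).injective⟩
  have mem : ∀ {T : Finset ℕ} (hT : T.card = r) {a b d : ℕ}, T ⊆ Finset.Icc 1 n →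
      a ∈ Finset.Icc 1 n → b ∈ Finset.Icc 1 n → d ∈ Finset.Icc 1 n → ∀ t,
        (Fin.cons a (Fin.cons b (Fin.cons d (T.orderEmbOfFin hT))) : Fin (r + 3) → ℕ) t ∈
          Finset.Icc 1 n := by
    intro T hT a b d hTn ha hb hd
    refine Fin.cases ha (Fin.cases hb (Fin.cases hd fun t => ?_))
    exact hTn (T.orderEmbOfFin_mem hT t)
  obtain ⟨σ, ⟨-, h0, w, hw⟩, hσ⟩ := exists_permSubgroup_apply_eq h _ _
    (inj hc hiS hjS hkS hij hjk hki) (inj hc' hiS' hjS' hkS' hij' hjk' hki')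
    (mem hc hS hi hj hk) (mem hc' hS' hi' hj' hk')
  refine ⟨w, σ, hw, h0, ?_, hσ 0, hσ (Fin.succ 0), hσ (Fin.succ (Fin.succ 0))⟩
  rw [← Finset.image_orderEmbOfFin_univ S hc, ← Finset.image_orderEmbOfFin_univ S' hc',
    Finset.image_image]
  exact Finset.image_congr fun t _ => hσ t.succ.succ.succ

/-! ### The reflection `s₀` -/

theorem form_comm (m n : ℕ) (x y : Lat n) : form m n x y = form m n y x := by
  rw [form_apply, form_apply]
  congr 1
  · ring
  · exact Finset.sum_congr rfl fun _ _ => mul_comm _ _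

theorem root_zero_eq_vecL (m n : ℕ) : root m n 0 = vecL n (Finset.Icc 1 m) := if_pos rfl

theorem vecL_sub_e {n i : ℕ} {S : Finset ℕ} (hi : i ∉ S) :
    vecL n S - e n i = vecL n (insert i S) := by
  rw [vecL, vecL, Finset.sum_insert hi]
  abel

/-- Here `⟨α₀, e_i⟩ = -1`, so the reflection adds `α₀`, which cancels `e_i`. -/
theorem s_zero_smul_e {m n : ℕ} (h : m < n) (i : ℕ) (h1 : 1 ≤ i) (hm : i ≤ m) :
    s h 0 (by omega) • e n i = vecL n ((Finset.Icc 1 m).erase i) := by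
  have hi : i ∈ Finset.Icc 1 m := Finset.mem_Icc.2 ⟨h1, hm⟩
  rw [s_smul, form_comm, form_e m n _ i h1 (by omega), root_zero_apply, if_neg (by simp; omega),
    if_pos ⟨h1, hm⟩, root_zero_eq_vecL]
  conv_lhs => rw [← Finset.insert_erase hi, ← vecL_sub_e (Finset.notMem_erase i _)]
  module

theorem s_zero_smul_e_of_lt {m n : ℕ} (h : m < n) (j : ℕ) (hm : m < j) (hn : j ≤ n) :
    s h 0 (by omega) • e n j = e n j := by
  rw [s_smul, form_comm, form_e m n _ j (by omega) hn, root_zero_apply, if_neg (by simp; omega),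
    if_neg (by simp; omega)]
  simp

theorem s_zero_smul_s_zero_smul {m n : ℕ} (h : m < n) (L : Lat n) :
    s h 0 (by omega) • s h 0 (by omega) • L = L :=
  Module.involutive_reflection (form_root_self m n 0 h (by omega)) L

theorem s_smul_vecL {m n : ℕ} (h : m < n) (i : ℕ) (hi : 1 ≤ i) (hn : i < n) (S : Finset ℕ) :
    s h i hn • vecL n S = vecL n (S.image (Equiv.swap i (i + 1))) :=
  smul_vecL (s_smul_e h i hi hn) (Equiv.swap_apply_of_ne_of_ne (by omega) (by omega)) S

theorem image_swap_eq_self {S : Finset ℕ} {a b : ℕ} (hab : a ∈ S ↔ b ∈ S) :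
    S.image (Equiv.swap a b) = S := by
  refine Finset.eq_of_subset_of_card_le (Finset.image_subset_iff.2 fun k hk => ?_)
    (Finset.card_image_of_injective S (Equiv.injective _)).ge
  rw [Equiv.swap_apply_def]
  split_ifs with h1 h2
  · exact hab.1 (h1 ▸ hk)
  · exact hab.2 (h2 ▸ hk)
  · exact hk

theorem image_swap_erase {S : Finset ℕ} {a b : ℕ} (ha : a ∈ S) (hb : b ∈ S) :
    (S.erase a).image (Equiv.swap a b) = S.erase b := by
  rw [Finset.image_erase (Equiv.injective _), image_swap_eq_self (iff_of_true ha hb),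
    Equiv.swap_apply_left]

/-! ### The action on the variables -/

section families

variable {m n : ℕ} {h : m < n} {F : Type*} [CommRing F]

theorem map_units_div {R : Type*} [CommRing R] (φ : F →+* R) {u v : Fˣ} {u' v' : Rˣ}
    (hu : φ u = u') (hv : φ v = v') : φ ((u / v : Fˣ) : F) = ((u' / v' : Rˣ) : R) := by
  have hu : Units.map (φ : F →* R) u = u' := Units.ext hu
  have hv : Units.map (φ : F →* R) v = v' := Units.ext hv
  rw [← hu, ← hv, ← map_div]
  rfl

namespace ActsThroughOrbit

variable {q : ℍ} {κ : K n →+* F} {t : M h → Fˣ} {ρ : W h →* (F ≃+* F)}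

theorem tau_eq (H : ActsThroughOrbit κ t ρ) (w : W h) {Λ Λ' : M h}
    (hΛ : w • (Λ : Lat n) = Λ') : ρ w (t Λ) = t Λ' := by
  rw [H.tau, show w • Λ = Λ' from Subtype.ext hΛ]

theorem f_eq (H : ActsThroughOrbit κ t ρ) (w : W h) {i : ℕ} {h1 : 1 ≤ i} {hi : i ≤ n}
    {Λ Λ' : M h} (hΛ : w • s h 0 (by omega) • e n i = Λ) (hΛ' : w • e n i = Λ') :
    ρ w (f t i h1 hi) = ((t Λ / t Λ' : Fˣ) : F) :=
  map_units_div (ρ w : F →+* F) (H.tau_eq w hΛ) (H.tau_eq w hΛ')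

end ActsThroughOrbit

/-- Clears denominators in the formula for `s_m(f_i)`: `v, p, r` stand for `τ_i, τ_m, τ_{m+1}` and
`y, x, u` for `τ(L - e_i), τ(L - e_m), τ(L - e_{m+1})`. The three products of the bilinear relation
result. -/
theorem units_div_eq_iff {u v p r x y : Fˣ} {a b : F} :
    ((u / v : Fˣ) : F) = (p / r : Fˣ) * (a * (x / v : Fˣ) + b * (y / p : Fˣ)) ↔
      (r * u : F) = a * (p * x) + b * (v * y) := by
  rw [← Units.mul_left_inj (v * r)]
  simp only [div_eq_mul_inv, Units.val_mul]
  refine Eq.congr ?_ ?_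
  · linear_combination (u * r : F) * v.inv_mul
  · linear_combination (p * a * x + p * b * y * v * p⁻¹ : F) * r.inv_mul
      + (p * a * x * r * r⁻¹ : F) * v.inv_mul + (b * y * v : F) * p.inv_mul

/-- The left-hand side of the bilinear relation for `L = e₀ - ∑_{l ∈ S} e_l` and `i, j, k`. -/
noncomputable def bilinearForm (q : ℍ) (κ : K n →+* F) (t : M h → Fˣ) (S : Finset ℕ)
    (hS : S ⊆ Finset.Icc 1 n)
    (hc : S.card + 2 = m) (i j k : ℕ) (hi : i ∈ Finset.Icc 1 n) (hj : j ∈ Finset.Icc 1 n)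
    (hk : k ∈ Finset.Icc 1 n) (hiS : i ∉ S) (hjS : j ∉ S) (hkS : k ∉ S) : F :=
  κ (br q (e n j - e n k) * br q (vecL n S - e n j - e n k)) *
      (t ⟨e n i, e_mem_M h i (Finset.mem_Icc.1 hi).1 (Finset.mem_Icc.1 hi).2⟩ *
        t (ptL h S hS hc i hi hiS)) +
    κ (br q (e n k - e n i) * br q (vecL n S - e n k - e n i)) *
      (t ⟨e n j, e_mem_M h j (Finset.mem_Icc.1 hj).1 (Finset.mem_Icc.1 hj).2⟩ *
        t (ptL h S hS hc j hj hjS)) +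
    κ (br q (e n i - e n j) * br q (vecL n S - e n i - e n j)) *
      (t ⟨e n k, e_mem_M h k (Finset.mem_Icc.1 hk).1 (Finset.mem_Icc.1 hk).2⟩ *
        t (ptL h S hS hc k hk hkS))

variable {q : ℍ} {κ : K n →+* F} {t : M h → Fˣ} {ρ : W h →* (F ≃+* F)}

theorem map_bilinearForm (H : ActsThroughOrbit κ t ρ) {w : W h} {σ : Equiv.Perm ℕ}
    (hw : Permutes w σ) (h0 : σ 0 = 0) {S S' : Finset ℕ} (hσS : S.image σ = S')
    {i j k i' j' k' : ℕ} (hσi : σ i = i') (hσj : σ j = j') (hσk : σ k = k')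
    (hS : S ⊆ Finset.Icc 1 n) (hc : S.card + 2 = m) (hi : i ∈ Finset.Icc 1 n)
    (hj : j ∈ Finset.Icc 1 n) (hk : k ∈ Finset.Icc 1 n) (hiS : i ∉ S) (hjS : j ∉ S) (hkS : k ∉ S)
    (hS' : S' ⊆ Finset.Icc 1 n) (hc' : S'.card + 2 = m) (hi' : i' ∈ Finset.Icc 1 n)
    (hj' : j' ∈ Finset.Icc 1 n) (hk' : k' ∈ Finset.Icc 1 n) (hiS' : i' ∉ S') (hjS' : j' ∉ S')
    (hkS' : k' ∉ S') :
    ρ w (bilinearForm q κ t S hS hc i j k hi hj hk hiS hjS hkS) =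
      bilinearForm q κ t S' hS' hc' i' j' k' hi' hj' hk' hiS' hjS' hkS' := by
  have e0 : ∀ Λ Λ' : Lat n, kAct (w : Lat n ≃ₗ[ℤ] Lat n) (br q Λ * br q Λ') =
      br q ((w : Lat n ≃ₗ[ℤ] Lat n) Λ) * br q ((w : Lat n ≃ₗ[ℤ] Lat n) Λ') :=
    fun Λ Λ' => by rw [map_mul, kAct_br, kAct_br]
  have e1 : ∀ a b, (w : Lat n ≃ₗ[ℤ] Lat n) (e n a - e n b) = e n (σ a) - e n (σ b) :=
    fun a b => by rw [map_sub, ← hw, ← hw]; rfl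
  have e2 : ∀ a b, (w : Lat n ≃ₗ[ℤ] Lat n) (vecL n S - e n a - e n b) =
      vecL n S' - e n (σ a) - e n (σ b) :=
    fun a b => by rw [map_sub, map_sub, ← hw, ← hw, ← hσS, ← smul_vecL hw h0]; rfl
  have e3 : ∀ a, w • (vecL n S - e n a) = vecL n S' - e n (σ a) :=
    fun a => by rw [smul_sub, hw, smul_vecL hw h0, hσS]
  subst hσi hσj hσk
  simp only [bilinearForm, map_add, map_mul (ρ w), H.coeff, e0, e1, e2]
  rw [H.tau_eq w (Λ := ⟨e n i, _⟩) (Λ' := ⟨e n (σ i), e_mem_M h _ (Finset.mem_Icc.1 hi').1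
      (Finset.mem_Icc.1 hi').2⟩) (hw i),
    H.tau_eq w (Λ := ⟨e n j, _⟩) (Λ' := ⟨e n (σ j), e_mem_M h _ (Finset.mem_Icc.1 hj').1
      (Finset.mem_Icc.1 hj').2⟩) (hw j),
    H.tau_eq w (Λ := ⟨e n k, _⟩) (Λ' := ⟨e n (σ k), e_mem_M h _ (Finset.mem_Icc.1 hk').1
      (Finset.mem_Icc.1 hk').2⟩) (hw k),
    H.tau_eq w (Λ := ptL h S hS hc i hi hiS)
      (Λ' := ptL h _ hS' hc' _ hi' hiS') (e3 i),
    H.tau_eq w (Λ := ptL h S hS hc j hj hjS)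
      (Λ' := ptL h _ hS' hc' _ hj' hjS') (e3 j),
    H.tau_eq w (Λ := ptL h S hS hc k hk hkS)
      (Λ' := ptL h _ hS' hc' _ hk' hkS') (e3 k)]

/-- The two sides differ by the factor `[ε_i - ε_m][α₀]`, the common denominator (up to sign) of
`c_{i,m}` and `c_{m,i}`. -/
theorem bilinearForm_eq_zero_iff (H : ActsThroughOrbit κ t ρ) {i : ℕ} (h1 : 1 ≤ i) (hm : i < m)
    {S : Finset ℕ} (hSdef : S = (Finset.Icc 1 (m - 1)).erase i) (hS hc hi hj hk hiS hjS hkS) :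
    bilinearForm q κ t S hS hc i m (m + 1) hi hj hk hiS hjS hkS = 0 ↔
      ρ (s h m h) (f t i h1 (by omega)) =
        (tau t m (by omega) (by omega) / tau t (m + 1) (by omega) h : Fˣ) *
          (κ (c m n q i m) * f t i h1 (by omega) +
            κ (c m n q m i) * f t m (by omega) (by omega)) := by
  have sm : (Finset.Icc 1 m).erase m = insert i S := by
    rw [hSdef, Finset.insert_erase (Finset.mem_Icc.2 ⟨h1, by omega⟩)]
    ext a
    simp only [Finset.mem_erase, Finset.mem_Icc]
    omega
  have si : (Finset.Icc 1 m).erase i = insert m S := by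
    ext a
    simp only [hSdef, Finset.mem_erase, Finset.mem_Icc, Finset.mem_insert]
    omega
  have pm : s h 0 (by omega) • e n m = vecL n S - e n i := by
    rw [s_zero_smul_e h m (by omega) le_rfl, sm, vecL_sub_e hiS]
  have pi : s h 0 (by omega) • e n i = vecL n S - e n m := by
    rw [s_zero_smul_e h i h1 (by omega), si, vecL_sub_e hjS]
  have hα : root m n 0 = vecL n S - e n i - e n m := by
    rw [root_zero_eq_vecL, vecL_sub_e hiS, vecL_sub_e (by simp [hjS]; omega), ← sm,
      Finset.insert_erase (Finset.mem_Icc.2 ⟨by omega, le_rfl⟩)]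
  have psm : s h m h • s h 0 (by omega) • e n i = vecL n S - e n (m + 1) := by
    rw [pi, smul_sub, s_smul_vecL h m (by omega) h, s_smul_e h m (by omega) h,
      image_swap_eq_self (iff_of_false hjS hkS), Equiv.swap_apply_left]
  have fi : f t i h1 (by omega) = t (ptL h S hS hc m hj hjS) / tau t i h1 (by omega) := by
    rw [f, tau]; congr 2; exact Subtype.ext pi
  have fm : f t m (by omega) (by omega) =
      t (ptL h S hS hc i hi hiS) / tau t m (by omega) (by omega) := by
    rw [f, tau]; congr 2; exact Subtype.ext pm
  have fsi : ρ (s h m h) (f t i h1 (by omega)) =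
      ((t (ptL h S hS hc (m + 1) hk hkS) / tau t i h1 (by omega) : Fˣ) : F) := by
    refine H.f_eq _ psm ?_
    rw [s_smul_e h m (by omega) h, Equiv.swap_apply_of_ne_of_ne (by omega) (by omega)]
    rfl
  rw [fsi, fi, fm, units_div_eq_iff]
  have hne : br q (e n i - e n m) ≠ 0 := br_ne_zero q fun h0 => by
    have := congrFun h0 ⟨i, by omega⟩
    simp [e, (show i ≠ m by omega)] at this
  have hne0 : br q (root m n 0) ≠ 0 := br_ne_zero q fun h0 => by
    have := congrFun h0 0
    simp [root_zero_apply] at this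
  -- `F` may have zero divisors, but nonzero elements of the field `K` become units in it, so the
  -- factor can be cancelled.
  have hu : IsUnit (κ (br q (e n i - e n m) * br q (root m n 0))) :=
    (IsUnit.mk0 _ (mul_ne_zero hne hne0)).map κ
  have c1 : br q (e n i - e n m) * br q (root m n 0) * c m n q i m =
      br q (e n i - e n (m + 1)) * br q (vecL n S - e n (m + 1) - e n i) := by
    rw [c, mul_div_cancel₀ _ (mul_ne_zero hne hne0), hα]
    congr 2
    abel
  have c2 : br q (e n i - e n m) * br q (root m n 0) * c m n q m i =
      -(br q (e n m - e n (m + 1)) * br q (vecL n S - e n m - e n (m + 1))) := by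
    have : root m n 0 + e n i - e n (m + 1) = vecL n S - e n m - e n (m + 1) := by
      rw [hα]; abel
    rw [c, this, br_sub_comm q (e n m) (e n i)]
    field_simp
  refine Iff.trans ?_ hu.mul_right_inj
  rw [mul_add, ← mul_assoc _ (κ (c m n q i m)), ← mul_assoc _ (κ (c m n q m i)),
    ← map_mul κ _ (c m n q i m), ← map_mul κ _ (c m n q m i), c1, c2, hα, bilinearForm,
    br_sub_comm q (e n (m + 1)) (e n i), neg_mul, map_neg, map_neg]
  change _ = 0 ↔ _ * ((t ⟨e n (m + 1), _⟩ : F) * _) =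
    _ * (t ⟨e n m, _⟩ * _) + _ * (t ⟨e n i, _⟩ * _)
  constructor <;> intro h' <;> linear_combination h'

/-- Under an action of the Weyl group through the orbit, the birational transformations are
equivalent to the bilinear relations. -/
theorem birationalTransformations_iff (H : ActsThroughOrbit κ t ρ) :
    BirationalTransformations q κ t ρ ↔ BilinearRelations q κ t := by
  constructor
  · intro B S hS hc i j k hi hj hk hiS hjS hkS hij hjk hki
    -- The formula for `s_m(f_{m-1})` alone suffices: it gives the relation for `S = {1,…,m-2}` and
    -- `(m-1, m, m+1)`, to which all others are conjugate. The hypothesis `hc` forces `m ≥ 2`.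
    have hS₀ : (Finset.Icc 1 (m - 1)).erase (m - 1) ⊆ Finset.Icc 1 n := fun a => by
      simp only [Finset.mem_erase, Finset.mem_Icc]
      omega
    have hc₀ : ((Finset.Icc 1 (m - 1)).erase (m - 1)).card + 2 = m := by
      rw [Finset.card_erase_of_mem (Finset.mem_Icc.2 ⟨by omega, le_rfl⟩), Nat.card_Icc]
      omega
    have hi₀ : m - 1 ∈ Finset.Icc 1 n := Finset.mem_Icc.2 ⟨by omega, by omega⟩
    have hj₀ : m ∈ Finset.Icc 1 n := Finset.mem_Icc.2 ⟨by omega, by omega⟩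
    have hk₀ : m + 1 ∈ Finset.Icc 1 n := Finset.mem_Icc.2 ⟨by omega, by omega⟩
    have hiS₀ : m - 1 ∉ (Finset.Icc 1 (m - 1)).erase (m - 1) := Finset.notMem_erase _ _
    have hjS₀ : m ∉ (Finset.Icc 1 (m - 1)).erase (m - 1) := by
      simp only [Finset.mem_erase, Finset.mem_Icc]
      omega
    have hkS₀ : m + 1 ∉ (Finset.Icc 1 (m - 1)).erase (m - 1) := by
      simp only [Finset.mem_erase, Finset.mem_Icc]
      omega
    obtain ⟨w, σ, hw, h0, hσS, hσi, hσj, hσk⟩ := exists_permutes_configuration h hS₀ hS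
      (r := m - 2) (by omega) (by omega) hi₀ hj₀ hk₀ hiS₀ hjS₀ hkS₀ (by omega) (by omega)
      (by omega) hi hj hk hiS hjS hkS hij hjk hki
    have := (bilinearForm_eq_zero_iff H (q := q) (by omega) (by omega) rfl hS₀ hc₀ hi₀ hj₀ hk₀ hiS₀
      hjS₀ hkS₀).2 (B.s_m_f (m - 1) (by omega) (by omega))
    change bilinearForm q κ t S hS hc i j k hi hj hk hiS hjS hkS = 0
    rw [← map_bilinearForm H hw h0 hσS hσi hσj hσk hS₀ hc₀ hi₀ hj₀ hk₀ hiS₀ hjS₀ hkS₀, this, map_zero]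
  · intro B
    constructor
    case s_zero_tau =>
      intro i h1 hm
      rw [tau, H.tau, f, ← Units.val_mul, div_mul_cancel]
    case s_zero_tau_fix =>
      intro j hm hn
      exact H.tau_eq _ (s_zero_smul_e_of_lt h j hm hn)
    case s_tau_left =>
      intro i h1 hn
      refine H.tau_eq _ ?_
      change _ • e n i = e n (i + 1)
      rw [s_smul_e h i h1 hn, Equiv.swap_apply_left]
    case s_tau_right =>
      intro i h1 hn
      refine H.tau_eq _ ?_
      change _ • e n (i + 1) = e n i
      rw [s_smul_e h i h1 hn, Equiv.swap_apply_right]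
    case s_tau_fix =>
      intro i j h1 hn hj1 hjn hji hji'
      refine H.tau_eq _ ?_
      change _ • e n j = e n j
      rw [s_smul_e h i h1 hn, Equiv.swap_apply_of_ne_of_ne hji hji']
    case s_zero_f =>
      intro i h1 hm
      rw [f, inv_div]
      exact H.f_eq _ (s_zero_smul_s_zero_smul h _) rfl
    case s_f_left =>
      intro i h1 hm
      refine H.f_eq _ ?_ ?_
      · change _ = s h 0 (by omega) • e n (i + 1)
        rw [s_zero_smul_e h i h1 (by omega), s_zero_smul_e h (i + 1) (by omega) (by omega),
          s_smul_vecL h i h1 (by omega), image_swap_erase]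
        all_goals simp only [Finset.mem_Icc]; omega
      · rw [s_smul_e h i h1 (by omega), Equiv.swap_apply_left]
        rfl
    case s_f_right =>
      intro i h1 hm
      refine H.f_eq _ ?_ ?_
      · change _ = s h 0 (by omega) • e n i
        rw [s_zero_smul_e h i h1 (by omega), s_zero_smul_e h (i + 1) (by omega) (by omega),
          s_smul_vecL h i h1 (by omega), Equiv.swap_comm, image_swap_erase]
        all_goals simp only [Finset.mem_Icc]; omega
      · rw [s_smul_e h i h1 (by omega), Equiv.swap_apply_right]
        rfl
    case s_m_f =>
      intro i h1 hm
      -- The only transformation that needs the bilinear relations.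
      refine (bilinearForm_eq_zero_iff H h1 hm rfl ?hS ?hc ?hi ?hj ?hk ?hiS ?hjS ?hkS).1
        (B _ ?hS ?hc i m (m + 1) ?hi ?hj ?hk ?hiS ?hjS ?hkS (by omega) (by omega) (by omega))
      · intro a
        simp only [Finset.mem_erase, Finset.mem_Icc]
        omega
      · rw [Finset.card_erase_of_mem (Finset.mem_Icc.2 ⟨h1, by omega⟩), Nat.card_Icc]
        omega
      all_goals simp only [Finset.mem_erase, Finset.mem_Icc]; omega
    case s_m_f_m =>
      intro hm
      -- The factor `τ_m` telescopes, and `s_m` fixes `s₀.e_m = e₀ - e₁ - ⋯ - e_{m-1}`, in which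
      -- neither `e_m` nor `e_{m+1}` occurs.
      have : (tau t m hm (by omega) / tau t (m + 1) (by omega) h) * f t m hm (by omega) =
          t (s h 0 (by omega) • pt h m hm (by omega)) / tau t (m + 1) (by omega) h := by
        rw [f, tau, mul_comm, div_mul_div_cancel]
      rw [← Units.val_mul, this]
      refine H.f_eq _ ?_ ?_
      · change _ = s h 0 (by omega) • e n m
        rw [s_zero_smul_e h m hm le_rfl, s_smul_vecL h m hm h, image_swap_eq_self]
        simp
      · rw [s_smul_e h m hm h, Equiv.swap_apply_left]
        rfl
    case s_f_fix =>
      intro i j h1 hn hj1 hjm him hji hji'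
      refine H.f_eq _ ?_ ?_
      · change _ = s h 0 (by omega) • e n j
        -- Since `i ≠ m` and `j ≠ i, i+1`, the set `{1,…,m} \ {j}` contains both or neither of `i`
        -- and `i+1`.
        rw [s_zero_smul_e h j hj1 hjm, s_smul_vecL h i h1 hn, image_swap_eq_self]
        simp only [Finset.mem_erase, Finset.mem_Icc]
        omega
      · rw [s_smul_e h i h1 hn, Equiv.swap_apply_of_ne_of_ne hji hji']
        rfl

/-- The bilinear relations are preserved by the ring homomorphisms. -/
theorem BilinearRelations.map {R : Type*} [CommRing R] {κ' : K n →+* R} {t' : M h → Rˣ}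
    (B : BilinearRelations q κ t) (φ : F →+* R) (hκ : ∀ a, φ (κ a) = κ' a)
    (ht : ∀ Λ, φ (t Λ) = t' Λ) : BilinearRelations q κ' t' := by
  intro S hS hc i j k hi hj hk hiS hjS hkS hij hjk hki
  have := congrArg φ (B S hS hc i j k hi hj hk hiS hjS hkS hij hjk hki)
  simpa only [map_add, map_mul φ, hκ, ht, map_zero] using this

/-! ### The coinduced action -/

/-- The action of a group `G` on the functions `G → R` by right translation. -/
def translationAction (G R : Type*) [Group G] [CommRing R] : G →* ((G → R) ≃+* (G → R)) where
  toFun g :=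
    { toFun x w := x (w * g)
      invFun x w := x (w * g⁻¹)
      left_inv x := funext fun w => congrArg x (inv_mul_cancel_right w g)
      right_inv x := funext fun w => congrArg x (mul_inv_cancel_right w g)
      map_mul' _ _ := rfl
      map_add' _ _ := rfl }
  map_one' := RingEquiv.ext fun x => funext fun w => congrArg x (mul_one w)
  map_mul' g g' := RingEquiv.ext fun x => funext fun w => congrArg x (mul_assoc w g g').symm

theorem consistent_of_bilinearRelations {F : Type*} [CommRing F] {κ : K n →+* F} {t : M h → Fˣ}
    (B : ∀ w : W h, BilinearRelations q
      (κ.comp (kAct (w : Lat n ≃ₗ[ℤ] Lat n)).toRingHom) (fun Λ => t (w • Λ))) :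
    Consistent q κ t := by
  -- Coefficients are twisted by `w` in the component `w`; with constant coefficients, right
  -- translation would not extend the action on `K`.
  let κA : K n →+* (W h → F) :=
    RingHom.pi fun w => κ.comp (kAct (w : Lat n ≃ₗ[ℤ] Lat n)).toRingHom
  let T : M h → (W h → F)ˣ := fun Λ => MulEquiv.piUnits.symm fun w => t (w • Λ)
  have H : ActsThroughOrbit κA T (translationAction (W h) F) := by
    constructor
    · intro w a
      funext g
      exact congrArg κ (kAct_mul (g : Lat n ≃ₗ[ℤ] Lat n) w a)
    · intro w Λ
      funext g
      exact congrArg (fun Λ => (t Λ : F)) (mul_smul g w Λ)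
  refine ⟨W h → F, inferInstance, κA, T, translationAction (W h) F, Pi.evalRingHom _ 1, H,
    (birationalTransformations_iff H).2 ?_, ?_, ?_⟩
  · intro S hS hc i j k hi hj hk hiS hjS hkS hij hjk hki
    exact funext fun w => B w S hS hc i j k hi hj hk hiS hjS hkS hij hjk hki
  · refine RingHom.ext fun a => ?_
    change κ (kAct 1 a) = κ a
    rw [kAct_one]
  · intro Λ
    change (t ((1 : W h) • Λ) : F) = t Λ
    rw [one_smul]

/-- The relations hold in `A` by (i), and `φ ∘ ρ w` carries them to their `w`-transforms in `F`. -/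
theorem bilinearRelations_of_consistent {F : Type*} [CommRing F] {κ : K n →+* F} {t : M h → Fˣ}
    (C : Consistent q κ t) (w : W h) : BilinearRelations q
      (κ.comp (kAct (w : Lat n ≃ₗ[ℤ] Lat n)).toRingHom) (fun Λ => t (w • Λ)) := by
  obtain ⟨A, _, κA, T, ρ, φ, H, B, rfl, hφ⟩ := C
  refine ((birationalTransformations_iff H).1 B).map (φ.comp (ρ w : A →+* A)) (fun a => ?_)
    (fun Λ => ?_)
  · exact congrArg φ (H.coeff w a)
  · exact (congrArg φ (H.tau w Λ)).trans (hφ _)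

end families

end EllTau

theorem mainTheorem4 {m n : ℕ} (hm : 0 < m) (hmn : m < n) (q : UpperHalfPlane)
    {F : Type*} [CommRing F] (κ : EllTau.K n →+* F) (t : EllTau.M hmn → Fˣ) :
    (∀ ρ : EllTau.W hmn →* (F ≃+* F), EllTau.ActsThroughOrbit κ t ρ →
      (EllTau.BirationalTransformations q κ t ρ ↔ EllTau.BilinearRelations q κ t)) ∧
    (EllTau.Consistent q κ t ↔
      ∀ w : EllTau.W hmn,
        EllTau.BilinearRelations q
          (κ.comp (EllTau.kAct (w : EllTau.Lat n ≃ₗ[ℤ] EllTau.Lat n)).toRingHom)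
          (fun Λ => t (w • Λ))) :=
  ⟨fun _ H => EllTau.birationalTransformations_iff H,
    EllTau.bilinearRelations_of_consistent, EllTau.consistent_of_bilinearRelations⟩
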